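/- **Proposition (Strategy complexity for finitary Büchi games).** An *arena* is a countable (possibly infinite) directed graph $(V,E)$ in which every vertex has an outgoing edge, with a partition $V=V_E\sqcup V_A$ into Eve's and Adam's vertices. A *play* is an infinite path $\pi=\pi_0\pi_1\cdots$. For $F\subseteq V$ let $\mathrm{dist}_k(\pi,F)=\inf\{k'-k \mid k'\ge k,\ \pi_{k'}\in F\}\in\mathbb N\cup\{\infty\}$. In the *finitary Büchi game* given by an arena and $F$, Eve wins the plays in $$\mathrm{FinB\ddot uchi}(F)=\{\pi \mid \limsup_{k}\,\mathrm{dist}_k(\pi,F)<\infty\}$$ and Adam wins all other plays. A strategy of a player maps a finite history $w\in V^*$ and a current vertex $v$ of that player to a successor of $v$. It is winning from $U\subseteq V$ if, for every initial vertex in $U$ and every strategy of the opponent, the resulting play is won by the player. The *winning set* of a player is the set of vertices $v$ such that the player has a winning strategy from $\{v\}$. A strategy is *positional* if its move depends only on the current vertex. It has *finite memory* if there are a finite set $M$, an initial state $m_0\in M$, an update function $\mu:M\times E\to M$ reading the edges taken, and a next-move function $\nu$, such that the move is always $\nu(v,m)$, where $v$ is the current vertex and $m$ the current memory state. A *pushdown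 arena* is given by a finite set $Q$ of control states partitioned into $Q_E$ and $Q_A$, a finite stack alphabet $\Gamma$ with a bottom symbol $\bot\notin\Gamma$, and a set of transitions that push a symbol $b\in\Gamma$ (depending on the top symbol in $\Gamma\cup\{\bot\}$), pop a top symbol $a\in\Gamma$, or leave the stack unchanged (depending on the top symbol). Its vertices are the configurations $(q,u\bot)$ with $q\in Q$, $u\in\Gamma^*$; its edges are given by the transitions; a configuration belongs to Eve iff its control state is in $Q_E$; every configuration is required to have an outgoing edge. The following hold. 1. In every finitary Büchi game, Eve has a positional strategy that is winning from her (whole) winning set. 2. In general, winning strategies for Adam require infinite memory, even on pushdown arenas: there are a pushdown arena, a set $F_0\subseteq Q$ of control states, and a configuration $v_0$ such that, in the finitary Büchi game with $F=\{(q,u\bot)\mid q\in F_0\}$, Adam has a winning strategy from $v_0$, but no strategy of Adam that is winning from $v_0$ has finite memory. -/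

import Mathlib

namespace InfGame

/-- The two players. -/
inductive Player where
  | eve
  | adam

/-- An arena on the vertex set `V`: a directed graph without dead ends, together with a
partition of the vertices into Eve's vertices and Adam's vertices, given by `owner`. -/
structure Arena (V : Type*) where
  owner : V → Player
  E : V → V → Prop
  noDeadEnd : ∀ v, ∃ v', E v v'

variable {V : Type*}

/-- The set of vertices controlled by a player. -/
def Arena.vertices (A : Arena V) (P : Player) : Set V := {v | A.owner v = P}

/-- The set `Π` of all plays: the infinite paths of the arena. -/
def Arena.plays (A : Arena V) : Set (ℕ → V) := {π | ∀ n, A.E (π n) (π (n + 1))}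

/-- A strategy of the player `P`: from a finite history `w` and a current vertex `v` that belongs
to `P`, it prescribes a legal move. -/
structure Strategy (A : Arena V) (P : Player) where
  next : List V → A.vertices P → V
  legal : ∀ (w : List V) (v : A.vertices P), A.E v (next w v)

/-- The move made after the history `w` at the vertex `v`, by the player who controls `v`. -/
def jointMove {A : Arena V} (σ : Strategy A .eve) (τ : Strategy A .adam) (w : List V) (v : V) : V :=
  match h : A.owner v with
  | .eve => σ.next w ⟨v, h⟩
  | .adam => τ.next w ⟨v, h⟩

/-- History (oldest vertex first, current vertex excluded) and current vertex after `n` moves. -/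
def playState {A : Arena V} (v₀ : V) (σ : Strategy A .eve) (τ : Strategy A .adam) :
    ℕ → List V × V
  | 0 => ([], v₀)
  | n + 1 =>
    let s := playState v₀ σ τ n
    (s.1 ++ [s.2], jointMove σ τ s.1 s.2)

/-- The play `π(v₀, σ, τ)`. -/
def play {A : Arena V} (v₀ : V) (σ : Strategy A .eve) (τ : Strategy A .adam) : ℕ → V :=
  fun n => (playState v₀ σ τ n).2

/-- Eve's strategy `σ` is winning from the set `U` for the condition `Ω`. -/
def Strategy.EveWinsFrom {A : Arena V} (σ : Strategy A .eve) (U : Set V) (Ω : Set (ℕ → V)) : Prop :=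
  ∀ v₀ ∈ U, ∀ τ : Strategy A .adam, play v₀ σ τ ∈ Ω

/-- Adam's strategy `τ` is winning from the set `U` in the game where Eve's condition is `Ω`;
Adam's own condition is `Π \ Ω`. -/
def Strategy.AdamWinsFrom {A : Arena V} (τ : Strategy A .adam) (U : Set V) (Ω : Set (ℕ → V)) :
    Prop :=
  ∀ v₀ ∈ U, ∀ σ : Strategy A .eve, play v₀ σ τ ∈ A.plays \ Ω

/-- Eve's winning set `W_E(A, Ω)`. -/
def Arena.eveWinningSet (A : Arena V) (Ω : Set (ℕ → V)) : Set V :=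
  {v | ∃ σ : Strategy A .eve, σ.EveWinsFrom {v} Ω}

/-- Adam's winning set `W_A(A, Ω)`. -/
def Arena.adamWinningSet (A : Arena V) (Ω : Set (ℕ → V)) : Set V :=
  {v | ∃ τ : Strategy A .adam, τ.AdamWinsFrom {v} Ω}

/-- A strategy is positional if the move depends on the current vertex only. -/
def Strategy.IsPositional {A : Arena V} {P : Player} (σ : Strategy A P) : Prop :=
  ∃ f : A.vertices P → V, ∀ w v, σ.next w v = f v

/-- A memory structure with set of memory states `M`. The update function reads the edge that is
taken; its values on pairs of vertices that are not edges are irrelevant to plays. -/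
structure MemoryStructure (V : Type*) (M : Type*) where
  init : M
  update : M → V × V → M

/-- The memory state reached from `m` by reading the consecutive edges of a finite path. -/
def MemoryStructure.run {M : Type*} (𝓜 : MemoryStructure V M) : M → List V → M
  | m, u :: v :: w => 𝓜.run (𝓜.update m (u, v)) (v :: w)
  | m, _ => m

/-- The strategy relies on the memory structure `𝓜`: its moves are given by a next-move function
of the current vertex and the current memory state. -/
def Strategy.ReliesOn {A : Arena V} {P : Player} {M : Type*} (σ : Strategy A P)
    (𝓜 : MemoryStructure V M) : Prop :=
  ∃ ν : A.vertices P → M → V, ∀ w v, σ.next w v = ν v (𝓜.run 𝓜.init (w ++ [(v : V)]))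

/-- The strategy relies on some memory structure with finitely many memory states. -/
def Strategy.HasFiniteMemory {A : Arena V} {P : Player} (σ : Strategy A P) : Prop :=
  ∃ (M : Type) (_ : Finite M) (𝓜 : MemoryStructure V M), σ.ReliesOn 𝓜

/-- `dist_k(π, F)`: number of steps from position `k` to the next visit of `F` (`⊤` if none). -/
noncomputable def buchiDist (π : ℕ → V) (F : Set V) (k : ℕ) : ℕ∞ :=
  sInf {d | ∃ k', k ≤ k' ∧ π k' ∈ F ∧ d = ((k' - k : ℕ) : ℕ∞)}

/-- The finitary Büchi condition: the plays along which the distances to the next visit of `F`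
have a finite limit superior. -/
def Arena.finBuchi (A : Arena V) (F : Set V) : Set (ℕ → V) :=
  {π | π ∈ A.plays ∧ Filter.limsup (buchiDist π F) Filter.atTop < ⊤}

/-- Transitions of a pushdown process with control states `Q` and stack alphabet `Γ`. A top symbol
in `Γ ∪ {⊥}` is an element of `Option Γ`, where `none` is the bottom symbol `⊥`. -/
inductive PDTransition (Q Γ : Type*) where
  | push (p : Q) (a : Option Γ) (b : Γ) (q : Q)
  | pop (p : Q) (a : Γ) (q : Q)
  | skip (p : Q) (a : Option Γ) (q : Q)

/-- A pushdown process with finitely many control states and stack symbols. -/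
structure PushdownProcess (Q Γ : Type*) where
  finiteStates : Finite Q
  finiteAlphabet : Finite Γ
  Δ : Set (PDTransition Q Γ)

/-- The edges between configurations. The configuration `(q, u⊥)` is the pair `(q, u)`, with the
top of the stack at the head of `u`; so `u.head?` is the top symbol, and is `none` for `⊥`. -/
inductive PushdownProcess.Step {Q Γ : Type*} (S : PushdownProcess Q Γ) :
    Q × List Γ → Q × List Γ → Prop
  | push {p q : Q} {b : Γ} {u : List Γ} (h : PDTransition.push p u.head? b q ∈ S.Δ) :
      S.Step (p, u) (q, b :: u)
  | pop {p q : Q} {a : Γ} {u : List Γ} (h : PDTransition.pop p a q ∈ S.Δ) :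
      S.Step (p, a :: u) (q, u)
  | skip {p q : Q} {u : List Γ} (h : PDTransition.skip p u.head? q ∈ S.Δ) :
      S.Step (p, u) (q, u)

/-- The pushdown arena of a pushdown process without dead ends, where the control states are
partitioned between the players by `owner`. -/
def PushdownProcess.arena {Q Γ : Type*} (S : PushdownProcess Q Γ) (owner : Q → Player)
    (h : ∀ c, ∃ c', S.Step c c') : Arena (Q × List Γ) where
  owner c := owner c.1
  E := S.Step
  noDeadEnd := h

end InfGame

/-!
Finitary Büchi means that the gaps between visits of `F` are bounded. *Regions* on which a
positional strategy of Eve confines the play and bounds the gaps can be glued along a well-ordering,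
because the region index never increases along a play; so there is a greatest region `X`. Suppose
that Eve plays any strategy from a vertex outside `X`. After every finite path avoiding `X`, Adam
can enforce an arbitrarily long gap and still avoid `X`. Otherwise some `N` bounds the gaps of all
continuations, and playing at each vertex as after the path ending there with the shortest remaining
gap makes the gap bound a rank that decreases until `F` is visited, which enlarges `X`.
Concatenating longer and longer gaps, Adam wins outside `X`.

For the second claim Adam chooses a height to climb to, and then loses sight of `F` for as long as
the descent takes. He wins by climbing higher and higher, whereas with finite memory a play that
returns to the bottom infinitely often is ultimately periodic.
-/

namespace InfGame

section Plays

variable {V : Type*} {A : Arena V}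

theorem jointMove_eve (σ : Strategy A .eve) (τ : Strategy A .adam) (w : List V) {v : V}
    (h : A.owner v = .eve) : jointMove σ τ w v = σ.next w ⟨v, h⟩ := by
  grind [jointMove]

theorem jointMove_adam (σ : Strategy A .eve) (τ : Strategy A .adam) (w : List V) {v : V}
    (h : A.owner v = .adam) : jointMove σ τ w v = τ.next w ⟨v, h⟩ := by
  grind [jointMove]

theorem edge_jointMove (σ : Strategy A .eve) (τ : Strategy A .adam) (w : List V) (v : V) :
    A.E v (jointMove σ τ w v) := by
  cases h : A.owner v with
  | eve => rw [jointMove_eve σ τ w h]; exact σ.legal w ⟨v, h⟩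
  | adam => rw [jointMove_adam σ τ w h]; exact τ.legal w ⟨v, h⟩

theorem playState_fst (v : V) (σ : Strategy A .eve) (τ : Strategy A .adam) (n : ℕ) :
    (playState v σ τ n).1 = (List.range n).map (play v σ τ) := by
  induction n with
  | zero => rfl
  | succ n ih => simp [playState, ih, List.range_succ, play]

theorem play_succ (v : V) (σ : Strategy A .eve) (τ : Strategy A .adam) (n : ℕ) :
    play v σ τ (n + 1) = jointMove σ τ ((List.range n).map (play v σ τ)) (play v σ τ n) := by
  rw [← playState_fst]; rfl

theorem play_mem_plays (v : V) (σ : Strategy A .eve) (τ : Strategy A .adam) :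
    play v σ τ ∈ A.plays := fun n => by
  rw [play_succ]; exact edge_jointMove σ τ _ _

theorem play_eq {σ : Strategy A .eve} {τ : Strategy A .adam} {π : ℕ → V}
    (h : ∀ n, π (n + 1) = jointMove σ τ ((List.range n).map π) (π n)) : play (π 0) σ τ = π := by
  have hstate : ∀ n, playState (π 0) σ τ n = ((List.range n).map π, π n) := fun n => by
    induction n with
    | zero => rfl
    | succ n ih => simp [playState, ih, List.range_succ, h n]
  exact funext fun n => congrArg Prod.snd (hstate n)

theorem exists_adam_play_eq (σ : Strategy A .eve) {π : ℕ → V} (hπ : π ∈ A.plays)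
    (hσ : ∀ n (h : A.owner (π n) = .eve), π (n + 1) = σ.next ((List.range n).map π) ⟨π n, h⟩) :
    ∃ τ : Strategy A .adam, play (π 0) σ τ = π := by
  classical
  let τ : Strategy A .adam :=
    { next w v := if A.E v (π (w.length + 1)) then π (w.length + 1) else (A.noDeadEnd v).choose
      legal w v := by
        split_ifs with h
        exacts [h, (A.noDeadEnd v).choose_spec] }
  refine ⟨τ, play_eq fun n => ?_⟩
  cases h : A.owner (π n) with
  | eve => rw [jointMove_eve σ τ _ h]; exact hσ n h
  | adam => simp [jointMove_adam σ τ _ h, τ, hπ n]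

/-- Eve's positional strategy given by a choice of a successor of each vertex. -/
def positionalStrategy {f : V → V} (hf : ∀ v, A.E v (f v)) : Strategy A .eve where
  next _ v := f v
  legal _ v := hf v

theorem exists_strategy (A : Arena V) (P : Player) : Nonempty (Strategy A P) := by
  choose f hf using A.noDeadEnd
  exact ⟨⟨fun _ v => f v, fun _ v => hf v⟩⟩

end Plays

section BoundedGaps

variable {V : Type*} {F : Set V} {π : ℕ → V}

/-- The sequences in which the distance to the next visit of `F` is bounded. The bound is over all
positions, not only over all large ones, which makes no difference. -/
def boundedGaps (F : Set V) : Set (ℕ → V) := {π | ∃ N, ∀ k, ∃ j ≤ N, π (k + j) ∈ F}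

theorem buchiDist_le_iff {k N : ℕ} : buchiDist π F k ≤ N ↔ ∃ j ≤ N, π (k + j) ∈ F := by
  constructor
  · intro h
    have hne : {d : ℕ∞ | ∃ k', k ≤ k' ∧ π k' ∈ F ∧ d = ((k' - k : ℕ) : ℕ∞)}.Nonempty := by
      by_contra hempty
      rw [buchiDist, Set.not_nonempty_iff_eq_empty.mp hempty, sInf_empty] at h
      exact absurd h (by simp)
    obtain ⟨k', hk, hF, hd⟩ := csInf_mem hne
    have hle : ((k' - k : ℕ) : ℕ∞) ≤ N := hd.symm.trans_le h
    exact ⟨k' - k, Nat.cast_le.mp hle, by rwa [Nat.add_sub_cancel' hk]⟩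
  · rintro ⟨j, hj, hF⟩
    have hmem : (j : ℕ∞) ∈ {d : ℕ∞ | ∃ k', k ≤ k' ∧ π k' ∈ F ∧ d = ((k' - k : ℕ) : ℕ∞)} :=
      ⟨k + j, Nat.le_add_right k j, hF, by rw [Nat.add_sub_cancel_left]⟩
    exact (sInf_le hmem).trans (Nat.cast_le.mpr hj)

theorem limsup_buchiDist_lt_top_iff :
    Filter.limsup (buchiDist π F) Filter.atTop < ⊤ ↔ π ∈ boundedGaps F := by
  constructor
  · intro h
    obtain ⟨N, hN⟩ := ENat.ne_top_iff_exists.mp h.ne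
    have hlt : Filter.limsup (buchiDist π F) Filter.atTop < ((N + 1 : ℕ) : ℕ∞) := by
      rw [← hN]; exact Nat.cast_lt.mpr N.lt_succ_self
    obtain ⟨K, hK⟩ := Filter.eventually_atTop.mp (Filter.eventually_lt_of_limsup_lt hlt)
    refine ⟨K + (N + 1), fun k => ?_⟩
    obtain ⟨j, hj, hF⟩ := buchiDist_le_iff.mp (hK (k + K) (Nat.le_add_left K k)).le
    exact ⟨K + j, by omega, by rwa [← Nat.add_assoc]⟩
  · rintro ⟨N, hN⟩
    refine lt_of_le_of_lt ?_ (ENat.natCast_lt_top N)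
    exact Filter.limsup_le_of_le (by isBoundedDefault)
      (Filter.Eventually.of_forall fun k => buchiDist_le_iff.mpr (hN k))

theorem finBuchi_eq (A : Arena V) (F : Set V) : A.finBuchi F = A.plays ∩ boundedGaps F :=
  Set.ext fun _ => and_congr_right fun _ => limsup_buchiDist_lt_top_iff

theorem mem_boundedGaps_of_shift (m : ℕ) (h : (fun n => π (m + n)) ∈ boundedGaps F) :
    π ∈ boundedGaps F := by
  obtain ⟨N, hN⟩ := h
  refine ⟨m + N, fun k => ?_⟩
  obtain ⟨j, hj, hF⟩ := hN k
  exact ⟨m + j, by omega, by rwa [Nat.add_left_comm]⟩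

theorem mem_boundedGaps_of_rank (ρ : ℕ → ℕ) {N : ℕ} (hN : ∀ n, ρ n ≤ N)
    (hρ : ∀ n, π (n + 1) ∈ F ∨ ρ (n + 1) < ρ n) : π ∈ boundedGaps F := by
  have hvisit : ∀ r k, ρ k ≤ r → ∃ j ≤ r + 1, π (k + j) ∈ F := by
    intro r
    induction r with
    | zero => exact fun k hk => ⟨1, le_rfl, (hρ k).resolve_right (by omega)⟩
    | succ r ih =>
      intro k hk
      rcases hρ k with hF | hlt
      · exact ⟨1, by omega, hF⟩
      · obtain ⟨j, hj, hF⟩ := ih (k + 1) (by omega)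
        exact ⟨1 + j, by omega, by rwa [← Nat.add_assoc]⟩
  exact ⟨N + 1, fun k => hvisit N k (hN k)⟩

theorem mem_boundedGaps_of_periodic {p : ℕ} (hp : 0 < p) (hπ : Function.Periodic π p)
    (h0 : π 0 ∈ F) : π ∈ boundedGaps F := by
  refine ⟨p, fun k => ⟨p - k % p, Nat.sub_le _ _, ?_⟩⟩
  have hk : k + (p - k % p) = (k / p + 1) * p := by
    have := Nat.div_add_mod k p
    have := Nat.mod_lt k hp
    rw [Nat.add_mul, Nat.mul_comm]
    omega
  rw [hk]
  exact (hπ.nat_mul_eq (k / p + 1)).symm ▸ h0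

theorem not_mem_boundedGaps_of_suffix
    (h : ∀ N, ∃ n g, g <:+ (List.range n).map π ∧ N < g.length ∧ ∀ x ∈ g, x ∉ F) :
    π ∉ boundedGaps F := by
  rintro ⟨N, hN⟩
  obtain ⟨n, g, ⟨w, hw⟩, hlen, hg⟩ := h N
  obtain ⟨j, hj, hF⟩ := hN w.length
  have hj' : j < g.length := by omega
  have hget : g[j] = π (w.length + j) := by
    have : (w ++ g)[w.length + j]? = some g[j] := by
      rw [List.getElem?_append_right (Nat.le_add_right _ _), Nat.add_sub_cancel_left,
        List.getElem?_eq_getElem hj']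
    grind
  exact hg _ (List.getElem_mem hj') (hget ▸ hF)

end BoundedGaps

section Regions

variable {V : Type*} {A : Arena V}

/-- The edges that are taken when Eve plays the positional strategy `f`. -/
def Arena.PositionalStep (A : Arena V) (f : V → V) (v v' : V) : Prop :=
  A.E v v' ∧ (A.owner v = .eve → v' = f v)

/-- The positional strategy `f` of Eve keeps the play in `X` and ensures the condition `Ω` there. -/
structure Arena.IsPositionalRegion (A : Arena V) (Ω : Set (ℕ → V)) (X : Set V) (f : V → V) :
    Prop where
  legal : ∀ v, A.E v (f v)
  closed : ∀ ⦃v v'⦄, v ∈ X → A.PositionalStep f v v' → v' ∈ X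
  wins : ∀ π, (∀ n, A.PositionalStep f (π n) (π (n + 1))) → π 0 ∈ X → π ∈ Ω

theorem Arena.IsPositionalRegion.eveWinsFrom {Ω : Set (ℕ → V)} {X : Set V} {f : V → V}
    (h : A.IsPositionalRegion Ω X f) :
    (positionalStrategy h.legal).EveWinsFrom X (A.plays ∩ Ω) := fun v hv τ => by
  have hplay := play_mem_plays v (positionalStrategy h.legal) τ
  refine ⟨hplay, h.wins _ (fun n => ⟨hplay n, fun ho => ?_⟩) hv⟩
  rw [play_succ, jointMove_eve _ _ _ ho]
  rfl

/-- Each vertex follows the strategy of the first region that contains it. -/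
theorem Arena.exists_isPositionalRegion_iUnion {Ω : Set (ℕ → V)}
    (hΩ : ∀ (π : ℕ → V) (m : ℕ), (fun n => π (m + n)) ∈ Ω → π ∈ Ω)
    {ι : Type*} {X : ι → Set V} {f : ι → V → V} (h : ∀ i, A.IsPositionalRegion Ω (X i) (f i)) :
    ∃ g, A.IsPositionalRegion Ω (⋃ i, X i) g := by
  obtain ⟨_, _⟩ := exists_wellFoundedLT ι
  have hleast : ∀ v ∈ ⋃ i, X i, ∃ i, IsLeast {i | v ∈ X i} i := fun v hv =>
    (WellFoundedLT.exists_minimal inferInstance _ (Set.mem_iUnion.mp hv)).imp fun _ =>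
      minimal_iff_isLeast.mp
  have hmove : ∀ v, ∃ v', A.E v v' ∧ ∀ i, IsLeast {i | v ∈ X i} i → v' = f i v := fun v => by
    by_cases hv : ∃ i, IsLeast {i | v ∈ X i} i
    · obtain ⟨i, hi⟩ := hv
      exact ⟨f i v, (h i).legal v, fun j hj => by rw [hi.unique hj]⟩
    · exact (A.noDeadEnd v).imp fun v' hE => ⟨hE, fun i hi => absurd ⟨i, hi⟩ hv⟩
  choose g hE hg using hmove
  have hstep : ∀ {v v' i}, IsLeast {i | v ∈ X i} i → A.PositionalStep g v v' →
      A.PositionalStep (f i) v v' := fun hi hs => ⟨hs.1, fun ho => (hs.2 ho).trans (hg _ _ hi)⟩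
  have hclosed : ∀ {v v' i}, IsLeast {i | v ∈ X i} i → A.PositionalStep g v v' → v' ∈ X i :=
    fun hi hs => (h _).closed hi.1 (hstep hi hs)
  refine ⟨g, hE, fun v v' hv hs => ?_, fun π hπ h0 => ?_⟩
  · obtain ⟨i, hi⟩ := hleast v hv
    exact Set.mem_iUnion.mpr ⟨i, hclosed hi hs⟩
  have hmem : ∀ n, π n ∈ ⋃ i, X i := fun n => by
    induction n with
    | zero => exact h0
    | succ n ih =>
      obtain ⟨i, hi⟩ := hleast _ ih
      exact Set.mem_iUnion.mpr ⟨i, hclosed hi (hπ n)⟩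
  choose i hi using fun n => hleast _ (hmem n)
  have hanti : Antitone i :=
    antitone_nat_of_succ_le fun n => (hi (n + 1)).2 (hclosed (hi n) (hπ n))
  obtain ⟨m, hm⟩ := WellFoundedLT.antitone_chain_condition hanti
  refine hΩ π m ((h (i m)).wins _ (fun n => ?_) (hi m).1)
  have hin := hi (m + n)
  rw [← hm (m + n) (Nat.le_add_right m n)] at hin
  exact hstep hin (hπ (m + n))

theorem Arena.exists_greatest_isPositionalRegion (A : Arena V) {Ω : Set (ℕ → V)}
    (hΩ : ∀ (π : ℕ → V) (m : ℕ), (fun n => π (m + n)) ∈ Ω → π ∈ Ω) :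
    ∃ X f, A.IsPositionalRegion Ω X f ∧ ∀ Y g, A.IsPositionalRegion Ω Y g → Y ⊆ X := by
  let I := {p : Set V × (V → V) // A.IsPositionalRegion Ω p.1 p.2}
  obtain ⟨f, hf⟩ := Arena.exists_isPositionalRegion_iUnion hΩ fun i : I => i.2
  exact ⟨_, f, hf, fun Y g hY => Set.subset_iUnion (fun i : I => i.1.1) ⟨(Y, g), hY⟩⟩

/-- The controllable predecessor: the vertices from which Eve can force the next vertex to be in
`Y`. -/
def Arena.cpre (A : Arena V) (Y : Set V) : Set V :=
  {v | (A.owner v = .eve → ∃ v', A.E v v' ∧ v' ∈ Y) ∧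
    (A.owner v = .adam → ∀ v', A.E v v' → v' ∈ Y)}

theorem Arena.cpre_mono {Y Z : Set V} (h : Y ⊆ Z) : A.cpre Y ⊆ A.cpre Z :=
  fun _ hv => ⟨fun he => (hv.1 he).imp fun _ => And.imp_right (@h _),
    fun ha v' hE => h (hv.2 ha v' hE)⟩

theorem Arena.IsPositionalRegion.exists_union_of_rank {F X Z : Set V} {f : V → V}
    (h : A.IsPositionalRegion (boundedGaps F) X f) {ρ : V → ℕ} {N : ℕ} (hN : ∀ v ∈ Z, ρ v ≤ N)
    (hρ : ∀ v ∈ Z, v ∈ A.cpre (X ∪ {v' ∈ Z | v' ∈ F ∨ ρ v' < ρ v})) :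
    ∃ g, A.IsPositionalRegion (boundedGaps F) (X ∪ Z) g := by
  have hmove : ∀ v, ∃ v', A.E v v' ∧ (v ∈ X → v' = f v) ∧
      (v ∈ Z \ X → A.owner v = .eve → v' ∈ X ∪ {v' ∈ Z | v' ∈ F ∨ ρ v' < ρ v}) := fun v => by
    by_cases hv : v ∈ Z \ X ∧ A.owner v = .eve
    · obtain ⟨v', hE, hv'⟩ := (hρ v hv.1.1).1 hv.2
      exact ⟨v', hE, fun hX => absurd hX hv.1.2, fun _ _ => hv'⟩
    · exact ⟨f v, h.legal v, fun _ => rfl, fun h₁ h₂ => absurd ⟨h₁, h₂⟩ hv⟩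
  choose g hE hgX hgZ using hmove
  have hstepX : ∀ {v v'}, v ∈ X → A.PositionalStep g v v' → A.PositionalStep f v v' :=
    fun hv hs => ⟨hs.1, fun ho => (hs.2 ho).trans (hgX _ hv)⟩
  have hstepZ : ∀ {v v'}, v ∈ Z \ X → A.PositionalStep g v v' →
      v' ∈ X ∪ {v' ∈ Z | v' ∈ F ∨ ρ v' < ρ v} := fun {v v'} hv hs => by
    cases ho : A.owner v with
    | eve => rw [hs.2 ho]; exact hgZ v hv ho
    | adam => exact (hρ v hv.1).2 ho v' hs.1
  have hclosed : ∀ ⦃v v'⦄, v ∈ X ∪ Z → A.PositionalStep g v v' → v' ∈ X ∪ Z := by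
    intro v v' hv hs
    by_cases hX : v ∈ X
    · exact Or.inl (h.closed hX (hstepX hX hs))
    · exact (hstepZ ⟨hv.resolve_left hX, hX⟩ hs).imp_right And.left
  refine ⟨g, hE, hclosed, fun π hπ h0 => ?_⟩
  by_cases hK : ∃ K, π K ∈ X
  · obtain ⟨K, hK⟩ := hK
    have hX : ∀ n, π (K + n) ∈ X := fun n => by
      induction n with
      | zero => exact hK
      | succ n ih => exact h.closed ih (hstepX ih (hπ (K + n)))
    exact mem_boundedGaps_of_shift K (h.wins _ (fun n => hstepX (hX n) (hπ (K + n))) hK)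
  · push Not at hK
    have hZ : ∀ n, π n ∈ Z := fun n => by
      induction n with
      | zero => exact h0.resolve_left (hK 0)
      | succ n ih => exact (hclosed (Or.inr ih) (hπ n)).resolve_left (hK (n + 1))
    exact mem_boundedGaps_of_rank (fun n => ρ (π n)) (fun n => hN _ (hZ n)) fun n =>
      ((hstepZ ⟨hZ n, hK n⟩ (hπ n)).resolve_left (hK (n + 1))).2

end Regions

section Trees

variable {α : Type*}

theorem map_range_prefix (π : ℕ → α) {m n : ℕ} (h : m ≤ n) :
    (List.range m).map π <+: (List.range n).map π := by
  obtain ⟨d, rfl⟩ := Nat.exists_eq_add_of_le h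
  rw [List.range_add, List.map_append]
  exact List.prefix_append _ _

theorem exists_branch {T : Set (List α)} (hT : T.Nonempty) {P : ℕ → List α → Prop}
    (hP : ∀ N, ∀ l ∈ T, ∃ l' ∈ T, l <+: l' ∧ l.length < l'.length ∧ P N l') :
    ∃ π : ℕ → α, ∀ N, ∃ n, N ≤ n ∧ (List.range n).map π ∈ T ∧ P N ((List.range n).map π) := by
  obtain ⟨l, hl⟩ := hT
  choose! next hnextT hnext hlt hnextP using hP
  let s : ℕ → List α := fun n => Nat.rec l next n
  have hsT : ∀ n, s n ∈ T := fun n => by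
    induction n with
    | zero => exact hl
    | succ n ih => exact hnextT n _ ih
  have hprefix : ∀ {m n}, m ≤ n → s m <+: s n := fun h =>
    Nat.rel_of_forall_rel_succ_of_le (· <+: ·) (fun n => hnext n _ (hsT n)) h
  have hlen : ∀ n, n ≤ (s n).length := fun n => by
    induction n with
    | zero => exact Nat.zero_le _
    | succ n ih => exact ih.trans_lt (hlt n _ (hsT n))
  let π : ℕ → α := fun n => (s (n + 1))[n]'(hlen (n + 1))
  have hπ : ∀ n, (List.range (s n).length).map π = s n := fun n => by
    refine List.ext_getElem (by simp) fun i _ hi => ?_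
    simp only [List.getElem_map, List.getElem_range, π]
    rcases le_total (i + 1) n with hin | hin
    · exact (hprefix hin).getElem _
    · exact ((hprefix hin).getElem hi).symm
  refine ⟨π, fun N => ⟨(s (N + 1)).length, N.le_succ.trans (hlen (N + 1)), ?_⟩⟩
  rw [hπ (N + 1)]
  exact ⟨hsT (N + 1), hnextP N _ (hsT N)⟩

/-- Within the tree `T`, every path that continues `l` outside `F` has length at most `n`. -/
def IsGapBound (T : Set (List α)) (F : Set α) (l : List α) (n : ℕ) : Prop :=
  ∀ g, l ++ g ∈ T → (∀ x ∈ g, x ∉ F) → g.length ≤ n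

theorem IsGapBound.exists_lt {T : Set (List α)} {F : Set α} {l : List α} {n : ℕ}
    (h : IsGapBound T F l n) {v : α} (hv : l ++ [v] ∈ T) (hF : v ∉ F) :
    ∃ m < n, IsGapBound T F (l ++ [v]) m := by
  have hn : 1 ≤ n := h [v] hv (by simpa using hF)
  refine ⟨n - 1, by omega, fun g hg hgF => ?_⟩
  have : (v :: g).length ≤ n := h (v :: g) (by simpa using hg) (by simpa using ⟨hF, hgF⟩)
  simp only [List.length_cons] at this
  omega

end Trees

section Losing

variable {V : Type*} {A : Arena V} {F X : Set V}

/-- The tree of the finite paths outside `X` along which Eve plays according to `σ`. -/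
def Strategy.tree (σ : Strategy A .eve) (X : Set V) : Set (List V) :=
  {l | (∀ v ∈ l, v ∉ X) ∧ ∀ w u v, w ++ [u] ++ [v] <+: l →
    A.E u v ∧ ∀ h : A.owner u = .eve, v = σ.next w ⟨u, h⟩}

theorem Strategy.singleton_mem_tree (σ : Strategy A .eve) {v : V} (hv : v ∉ X) :
    [v] ∈ σ.tree X := by
  refine ⟨by simpa using hv, fun w u v' h => ?_⟩
  have := h.length_le
  simp at this

theorem Strategy.append_mem_tree {σ : Strategy A .eve} {w : List V} {u v : V}
    (hw : w ++ [u] ∈ σ.tree X) (hv : v ∉ X) (hE : A.E u v)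
    (hσ : ∀ h : A.owner u = .eve, v = σ.next w ⟨u, h⟩) : w ++ [u] ++ [v] ∈ σ.tree X := by
  refine ⟨fun x hx => ?_, fun w' u' v' h => ?_⟩
  · rcases List.mem_append.mp hx with hx | hx
    · exact hw.1 x hx
    · exact List.mem_singleton.mp hx ▸ hv
  · rcases List.prefix_concat_iff.mp h with heq | h
    · obtain ⟨heq', rfl⟩ := List.append_singleton_inj.mp heq
      obtain ⟨rfl, rfl⟩ := List.append_singleton_inj.mp heq'
      exact ⟨hE, hσ⟩
    · exact hw.2 w' u' v' h

theorem Strategy.mem_cpre_of_mem_tree {σ : Strategy A .eve} {w : List V} {u : V}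
    (hw : w ++ [u] ∈ σ.tree X) : u ∈ A.cpre (X ∪ {v | w ++ [u] ++ [v] ∈ σ.tree X}) := by
  have hstep : ∀ v, A.E u v → (∀ h : A.owner u = .eve, v = σ.next w ⟨u, h⟩) →
      v ∈ X ∪ {v | w ++ [u] ++ [v] ∈ σ.tree X} := fun v hE hσ =>
    or_iff_not_imp_left.mpr fun hv => Strategy.append_mem_tree hw hv hE hσ
  refine ⟨fun h => ⟨_, σ.legal w ⟨u, h⟩, hstep _ (σ.legal w ⟨u, h⟩) fun _ => rfl⟩,
    fun h v hE => hstep v hE fun h' => ?_⟩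
  rw [h] at h'
  cases h'

theorem Strategy.exists_gap_mem_tree (σ : Strategy A .eve) {f : V → V}
    (hf : A.IsPositionalRegion (boundedGaps F) X f)
    (hmax : ∀ Y g, A.IsPositionalRegion (boundedGaps F) Y g → Y ⊆ X)
    {l : List V} (hl : l ∈ σ.tree X) (hne : l ≠ []) (N : ℕ) :
    ∃ m g, l ++ m ++ g ∈ σ.tree X ∧ N < g.length ∧ ∀ x ∈ g, x ∉ F := by
  by_contra! hbounded
  let bounds (v : V) : Set ℕ :=
    {n | ∃ w, l <+: w ++ [v] ∧ w ++ [v] ∈ σ.tree X ∧ IsGapBound (σ.tree X) F (w ++ [v]) n}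
  let Z : Set V := {v | (bounds v).Nonempty}
  have hN : ∀ {w v}, l <+: w ++ [v] → w ++ [v] ∈ σ.tree X → N ∈ bounds v := by
    rintro w v ⟨m, hm⟩ hw
    refine ⟨w, ⟨m, hm⟩, hw, fun g hg hgF => ?_⟩
    by_contra! hlt
    obtain ⟨x, hx, hxF⟩ := hbounded m g (hm ▸ hg) hlt
    exact hgF x hx hxF
  have hNZ : ∀ v ∈ Z, sInf (bounds v) ≤ N := fun v ⟨_, w, hlw, hw, _⟩ => Nat.sInf_le (hN hlw hw)
  have hrank : ∀ v ∈ Z,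
      v ∈ A.cpre (X ∪ {v' ∈ Z | v' ∈ F ∨ sInf (bounds v') < sInf (bounds v)}) := by
    intro v hv
    obtain ⟨w, hlw, hw, hbound⟩ := Nat.sInf_mem hv
    refine Arena.cpre_mono (Set.union_subset_union_right X fun v' hv' => ?_)
      (Strategy.mem_cpre_of_mem_tree hw)
    have hlw' : l <+: w ++ [v] ++ [v'] := hlw.trans (List.prefix_append _ _)
    refine ⟨⟨N, hN hlw' hv'⟩, or_iff_not_imp_left.mpr fun hF => ?_⟩
    obtain ⟨m, hm, hbound'⟩ := hbound.exists_lt hv' hF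
    exact (Nat.sInf_le (show m ∈ bounds v' from ⟨w ++ [v], hlw', hv', hbound'⟩)).trans_lt hm
  obtain ⟨g, hg⟩ := hf.exists_union_of_rank hNZ hrank
  obtain ⟨w, v, rfl⟩ := l.eq_nil_or_concat'.resolve_left hne
  exact hl.1 v (by simp) (hmax _ g hg (Or.inr ⟨N, hN List.prefix_rfl hl⟩))

theorem Strategy.exists_play_not_mem_boundedGaps (σ : Strategy A .eve) {f : V → V}
    (hf : A.IsPositionalRegion (boundedGaps F) X f)
    (hmax : ∀ Y g, A.IsPositionalRegion (boundedGaps F) Y g → Y ⊆ X) {v : V} (hv : v ∉ X) :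
    ∃ τ : Strategy A .adam, play v σ τ ∉ boundedGaps F := by
  obtain ⟨π, hπ⟩ := exists_branch (T := {l ∈ σ.tree X | [v] <+: l})
    (P := fun N l => ∃ g, g <:+ l ∧ N < g.length ∧ ∀ x ∈ g, x ∉ F)
    ⟨[v], σ.singleton_mem_tree hv, List.prefix_rfl⟩ fun N l ⟨hl, hvl⟩ => by
      obtain ⟨m, g, hmem, hlen, hg⟩ :=
        σ.exists_gap_mem_tree hf hmax hl (List.ne_nil_of_mem
          (hvl.subset (List.mem_singleton_self v))) N
      have hprefix : l <+: l ++ m ++ g := ⟨m ++ g, (List.append_assoc _ _ _).symm⟩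
      refine ⟨_, ⟨hmem, hvl.trans hprefix⟩, hprefix, ?_, g, List.suffix_append _ _, hlen, hg⟩
      simp only [List.length_append]
      omega
  have hedge : ∀ n, A.E (π n) (π (n + 1)) ∧ ∀ h : A.owner (π n) = .eve,
      π (n + 1) = σ.next ((List.range n).map π) ⟨π n, h⟩ := fun n => by
    obtain ⟨k, hk, hmem, -⟩ := hπ (n + 2)
    refine hmem.1.2 _ _ _ ?_
    simpa only [List.range_succ, List.map_append, List.map_singleton] using map_range_prefix π hk
  have hstart : π 0 = v := by
    obtain ⟨k, -, hmem, -⟩ := hπ 1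
    have := hmem.2.getElem (i := 0) (by simp)
    simpa using this.symm
  obtain ⟨τ, hτ⟩ := exists_adam_play_eq σ (fun n => (hedge n).1) fun n => (hedge n).2
  rw [hstart] at hτ
  refine ⟨τ, hτ ▸ not_mem_boundedGaps_of_suffix fun N => ?_⟩
  obtain ⟨n, -, -, hgap⟩ := hπ N
  exact ⟨n, hgap⟩

theorem exists_positional_eveWinsFrom_eveWinningSet (A : Arena V) (F : Set V) :
    ∃ σ : Strategy A .eve,
      σ.IsPositional ∧ σ.EveWinsFrom (A.eveWinningSet (A.finBuchi F)) (A.finBuchi F) := by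
  obtain ⟨X, f, hf, hmax⟩ :=
    A.exists_greatest_isPositionalRegion fun π m => mem_boundedGaps_of_shift (F := F) (π := π) m
  rw [finBuchi_eq]
  refine ⟨positionalStrategy hf.legal, ⟨fun v => f v, fun _ _ => rfl⟩, fun v hv => ?_⟩
  refine hf.eveWinsFrom v (of_not_not fun hvX => ?_)
  obtain ⟨σ, hσ⟩ := hv
  obtain ⟨τ, hτ⟩ := σ.exists_play_not_mem_boundedGaps hf hmax hvX
  exact hτ (hσ v rfl τ).2

end Losing

section FiniteMemory

variable {V : Type*}

theorem MemoryStructure.run_append_pair {M : Type*} (𝓜 : MemoryStructure V M) (m : M)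
    (w : List V) (u v : V) : 𝓜.run m (w ++ [u, v]) = 𝓜.update (𝓜.run m (w ++ [u])) (u, v) := by
  induction w generalizing m with
  | nil => rfl
  | cons a w ih =>
    cases w with
    | nil => rfl
    | cons b w => exact ih (𝓜.update m (a, b))

/-- Adam's memory state takes the same value at two of the visits of `c`, and the play continues
after both of them in the same way. -/
theorem Strategy.HasFiniteMemory.exists_periodic {A : Arena V} (hA : ∀ v, A.owner v = .adam)
    {τ : Strategy A .adam} (hτ : τ.HasFiniteMemory) (σ : Strategy A .eve) {v c : V}
    (hc : {n | play v σ τ n = c}.Infinite) :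
    ∃ i p, 0 < p ∧ play v σ τ i = c ∧ Function.Periodic (fun n => play v σ τ (i + n)) p := by
  obtain ⟨M, _, 𝓜, ν, hν⟩ := hτ
  set π := play v σ τ
  let mem (n : ℕ) : M := 𝓜.run 𝓜.init ((List.range n).map π ++ [π n])
  have hmove : ∀ n, π (n + 1) = ν ⟨π n, hA _⟩ (mem n) := fun n => by
    exact (play_succ v σ τ n).trans (by rw [jointMove_adam _ _ _ (hA _), hν])
  have hmem : ∀ n, mem (n + 1) = 𝓜.update (mem n) (π n, π (n + 1)) := fun n => by
    simp only [mem, List.range_succ, List.map_append, List.append_assoc]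
    exact 𝓜.run_append_pair _ _ _ _
  have hstep : ∀ {a b}, π a = π b → mem a = mem b →
      π (a + 1) = π (b + 1) ∧ mem (a + 1) = mem (b + 1) := fun {a b} hab hmemab => by
    have hab' : π (a + 1) = π (b + 1) := by simp only [hmove, hab, hmemab]
    exact ⟨hab', by rw [hmem, hmem, hmemab, hab, hab']⟩
  obtain ⟨i, hi, j, hj, hij, hmemij⟩ :=
    hc.exists_lt_map_eq_of_mapsTo (Set.mapsTo_univ mem _) Set.finite_univ
  obtain ⟨p, rfl⟩ := Nat.exists_eq_add_of_lt hij
  have hperiodic : ∀ n, π (i + (n + (p + 1))) = π (i + n) ∧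
      mem (i + (n + (p + 1))) = mem (i + n) := fun n => by
    induction n with
    | zero => simpa [Nat.add_assoc] using And.intro (hj.trans hi.symm) hmemij.symm
    | succ n ih =>
      rw [show i + (n + 1 + (p + 1)) = i + (n + (p + 1)) + 1 by omega]
      exact hstep (b := i + n) ih.1 ih.2
  exact ⟨i, p + 1, p.succ_pos, hi, fun n => (hperiodic n).1⟩

end FiniteMemory

section Climb

/-- In the state `true` Adam may push, or change to the state `false`, in which the stack is
emptied before the state `true` is resumed. -/
def climbProcess : PushdownProcess Bool Unit where
  finiteStates := inferInstance
  finiteAlphabet := inferInstance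
  Δ := {t | (∃ a, t = .push true a () true) ∨ (∃ a, t = .skip true a false) ∨
    t = .pop false () false ∨ t = .skip false none true}

theorem climbProcess_step_climb (u : List Unit) : climbProcess.Step (true, u) (true, () :: u) :=
  .push (Or.inl ⟨_, rfl⟩)

theorem climbProcess_step_turn (u : List Unit) : climbProcess.Step (true, u) (false, u) :=
  .skip (Or.inr (Or.inl ⟨_, rfl⟩))

theorem climbProcess_step_descend_iff {u : List Unit} {c : Bool × List Unit} :
    climbProcess.Step (false, () :: u) c ↔ c = (false, u) := by
  refine ⟨fun h => ?_, ?_⟩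
  · cases h <;> simp_all [climbProcess]
  · rintro rfl
    exact .pop (Or.inr (Or.inr (Or.inl rfl)))

theorem climbProcess_step_bottom_iff {c : Bool × List Unit} :
    climbProcess.Step (false, []) c ↔ c = (true, []) := by
  refine ⟨fun h => ?_, ?_⟩
  · cases h <;> simp_all [climbProcess]
  · rintro rfl
    exact .skip (Or.inr (Or.inr (Or.inr rfl)))

/-- Adam's move at time `t`: he pushes as long as the height of the stack is less than half of the
elapsed time. Hence, if the stack is empty at time `t`, he stops pushing at the height `t`. -/
def climbMove (t : ℕ) : Bool × List Unit → Bool × List Unit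
  | (true, u) => if 2 * u.length < t then (true, () :: u) else (false, u)
  | (false, _ :: u) => (false, u)
  | (false, []) => (true, [])

theorem climbProcess_step_climbMove (t : ℕ) :
    ∀ c, climbProcess.Step c (climbMove t c)
  | (true, u) => by
    rw [climbMove]
    split_ifs
    exacts [climbProcess_step_climb u, climbProcess_step_turn u]
  | (false, () :: _) => climbProcess_step_descend_iff.mpr rfl
  | (false, []) => climbProcess_step_bottom_iff.mpr rfl

/-- The arena of `climbProcess`, in which all configurations belong to Adam. -/
abbrev climbArena : Arena (Bool × List Unit) :=
  climbProcess.arena (fun _ => .adam) fun c => ⟨_, climbProcess_step_climbMove 0 c⟩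

/-- The configurations with control state `true`. -/
abbrev climbTarget : Set (Bool × List Unit) := {c | c.1 ∈ ({true} : Set Bool)}

/-- Adam's strategy that makes the moves `climbMove`. -/
def climbStrategy : Strategy climbArena .adam where
  next w v := climbMove w.length v
  legal w v := climbProcess_step_climbMove w.length v

theorem play_climbStrategy_succ (σ : Strategy climbArena .eve) (c : Bool × List Unit) (n : ℕ) :
    play c σ climbStrategy (n + 1) = climbMove n (play c σ climbStrategy n) := by
  rw [play_succ, jointMove_adam _ _ _ rfl]
  simp [climbStrategy]

section ClimbMove

variable {π : ℕ → Bool × List Unit} {t : ℕ}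

theorem climbMove_ascent (hπ : ∀ n, π (n + 1) = climbMove n (π n)) (ht : π t = (true, []))
    {j : ℕ} (hj : j ≤ t) : π (t + j) = (true, List.replicate j ()) := by
  induction j with
  | zero => exact ht
  | succ j ih =>
    rw [← Nat.add_assoc, hπ, ih (by omega), climbMove, if_pos, List.replicate_succ]
    rw [List.length_replicate]
    omega

theorem climbMove_descent (hπ : ∀ n, π (n + 1) = climbMove n (π n)) (ht : π t = (true, []))
    {i j : ℕ} (hij : i + j = t) :
    π (2 * t + 1 + j) = (false, List.replicate i ()) := by
  induction j generalizing i with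
  | zero =>
    obtain rfl : i = t := hij
    rw [Nat.add_zero, hπ, Nat.two_mul, climbMove_ascent hπ ht le_rfl, climbMove, if_neg]
    rw [List.length_replicate]
    omega
  | succ j ih =>
    rw [← Nat.add_assoc, hπ, ih (i := i + 1) (by omega), List.replicate_succ, climbMove]

theorem climbMove_return (hπ : ∀ n, π (n + 1) = climbMove n (π n)) (ht : π t = (true, [])) :
    π (3 * t + 2) = (true, []) := by
  have hbottom := climbMove_descent hπ ht (Nat.zero_add t)
  rw [show 3 * t + 2 = 2 * t + 1 + t + 1 by omega, hπ, hbottom, List.replicate_zero, climbMove]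

end ClimbMove

theorem play_climbStrategy_not_mem_boundedGaps (σ : Strategy climbArena .eve) :
    play (true, []) σ climbStrategy ∉ boundedGaps climbTarget := by
  have hπ := play_climbStrategy_succ σ (true, [])
  have hreturn : ∀ N, ∃ t, N ≤ t ∧ play (true, []) σ climbStrategy t = (true, []) := fun N => by
    induction N with
    | zero => exact ⟨0, le_rfl, rfl⟩
    | succ N ih =>
      obtain ⟨t, hNt, ht⟩ := ih
      exact ⟨3 * t + 2, by omega, climbMove_return hπ ht⟩
  rintro ⟨N, hN⟩
  obtain ⟨t, hNt, ht⟩ := hreturn N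
  obtain ⟨j, hj, hF⟩ := hN (2 * t + 1)
  rw [climbMove_descent hπ ht (Nat.sub_add_cancel (hj.trans hNt))] at hF
  exact Bool.false_ne_true hF

theorem climbArena_exists_return {π : ℕ → Bool × List Unit} (hπ : π ∈ climbArena.plays) {k : ℕ}
    (hk : (π k).1 = false) : ∃ k', k ≤ k' ∧ π k' = (true, []) := by
  obtain ⟨u, hu⟩ : ∃ u, π k = (false, u) := ⟨(π k).2, Prod.ext hk rfl⟩
  clear hk
  have hstep : climbProcess.Step (π k) (π (k + 1)) := hπ k
  induction u generalizing k with
  | nil =>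
    rw [hu, climbProcess_step_bottom_iff] at hstep
    exact ⟨k + 1, k.le_succ, hstep⟩
  | cons a u ih =>
    rw [hu, climbProcess_step_descend_iff] at hstep
    obtain ⟨k', hk', hreturn⟩ := ih hstep (hπ (k + 1))
    exact ⟨k', k.le_succ.trans hk', hreturn⟩

theorem play_mem_boundedGaps_of_hasFiniteMemory (σ : Strategy climbArena .eve)
    {τ : Strategy climbArena .adam} (hτ : τ.HasFiniteMemory) (c : Bool × List Unit) :
    play c σ τ ∈ boundedGaps climbTarget := by
  by_cases hinf : {n | play c σ τ n = (true, [])}.Infinite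
  · obtain ⟨i, p, hp, hi, hperiodic⟩ := hτ.exists_periodic (fun _ => rfl) σ hinf
    refine mem_boundedGaps_of_shift i (mem_boundedGaps_of_periodic hp hperiodic ?_)
    simp [hi]
  · obtain ⟨K, hK⟩ := (Set.not_infinite.mp hinf).bddAbove
    refine mem_boundedGaps_of_shift (K + 1) ⟨0, fun k => ⟨0, le_rfl, ?_⟩⟩
    by_contra hF
    obtain ⟨k', hk', hreturn⟩ := climbArena_exists_return (play_mem_plays c σ τ) (by simpa using hF)
    have := hK hreturn
    omega

end Climb

end InfGame

theorem mainTheorem4_general :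
    (∀ (V : Type*) (A : InfGame.Arena V) (F : Set V),
      ∃ σ : InfGame.Strategy A .eve,
        σ.IsPositional ∧ σ.EveWinsFrom (A.eveWinningSet (A.finBuchi F)) (A.finBuchi F)) ∧
    (∃ (Q Γ : Type) (S : InfGame.PushdownProcess Q Γ) (owner : Q → InfGame.Player)
      (h : ∀ c, ∃ c', S.Step c c') (F : Set Q) (v₀ : Q × List Γ),
      v₀ ∈ (S.arena owner h).adamWinningSet ((S.arena owner h).finBuchi {c | c.1 ∈ F}) ∧
      ∀ τ : InfGame.Strategy (S.arena owner h) .adam,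
        τ.AdamWinsFrom {v₀} ((S.arena owner h).finBuchi {c | c.1 ∈ F}) →
          ¬ τ.HasFiniteMemory) := by
  refine ⟨fun V A F => InfGame.exists_positional_eveWinsFrom_eveWinningSet A F, Bool, Unit,
    InfGame.climbProcess, fun _ => .adam, fun c => ⟨_, InfGame.climbProcess_step_climbMove 0 c⟩,
    {true}, (true, []), ?_, fun τ hτ hfin => ?_⟩
  · rw [InfGame.finBuchi_eq]
    refine ⟨InfGame.climbStrategy, ?_⟩
    rintro _ rfl σ
    exact ⟨InfGame.play_mem_plays _ _ _, fun h =>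
      InfGame.play_climbStrategy_not_mem_boundedGaps σ h.2⟩
  · rw [InfGame.finBuchi_eq] at hτ
    obtain ⟨σ⟩ := InfGame.exists_strategy InfGame.climbArena .eve
    exact (hτ _ rfl σ).2 ⟨InfGame.play_mem_plays _ _ _,
      InfGame.play_mem_boundedGaps_of_hasFiniteMemory σ hfin _⟩

theorem mainTheorem4 :
    (∀ (V : Type*) [Countable V] (A : InfGame.Arena V) (F : Set V),
      ∃ σ : InfGame.Strategy A .eve,
        σ.IsPositional ∧ σ.EveWinsFrom (A.eveWinningSet (A.finBuchi F)) (A.finBuchi F)) ∧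
    (∃ (Q Γ : Type) (S : InfGame.PushdownProcess Q Γ) (owner : Q → InfGame.Player)
      (h : ∀ c, ∃ c', S.Step c c') (F : Set Q) (v₀ : Q × List Γ),
      v₀ ∈ (S.arena owner h).adamWinningSet ((S.arena owner h).finBuchi {c | c.1 ∈ F}) ∧
      ∀ τ : InfGame.Strategy (S.arena owner h) .adam,
        τ.AdamWinsFrom {v₀} ((S.arena owner h).finBuchi {c | c.1 ∈ F}) →
          ¬ τ.HasFiniteMemory) :=
  mainTheorem4_general.imp_left fun h V _ A F => h V A F
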